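/- Let $R$ be a commutative ring with $1$ in which $2$ is invertible, and let $n \ge 1$. Let $\psi_1 = \begin{pmatrix} 0 & 1 \\ -1 & 0 \end{pmatrix}$, let $\psi_r = \psi_1 \perp \cdots \perp \psi_1$ ($r$ diagonal blocks), and for a commutative ring $S$ let $\mathrm{Sp}_{2n}(S) = \{\alpha \in \mathrm{SL}_{2n}(S) : \alpha^t \psi_n \alpha = \psi_n\}$. For a row $X = (X_2, \ldots, X_n)$ of $2 \times 2$ matrices over $S$ put $$E(X) = \begin{pmatrix} I_2 & X \\ \psi_{n-1} X^t \psi_1 & I_{2n-2} \end{pmatrix}.$$ For $a \in S$ let $A(a) = \begin{pmatrix} a & a \\ a & a \end{pmatrix}$, $B(a) = \begin{pmatrix} a & -a \\ a & -a \end{pmatrix}$, $C(a) = \begin{pmatrix} a & a \\ -a & -a \end{pmatrix}$, $D(a) = \begin{pmatrix} -a & a \\ a & -a \end{pmatrix}$. Let $H(S)$ be the subgroup of $\mathrm{Sp}_{2n}(S)$ generated by all the matrices $E(Y(a_2), \ldots, Y(a_n))$ with $Y \in \{A, B, C, D\}$ and $a_2, \ldots, a_n \in S$. **Theorem (Local Global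 Principle).** Let $\alpha(X) \in \mathrm{Sp}_{2n}(R[X])$ with $\alpha(0) = I_{2n}$. For a maximal ideal $\mathfrak{m}$ of $R$, let $\alpha(X)_{\mathfrak{m}}$ be the image of $\alpha(X)$ in $\mathrm{Sp}_{2n}(R_{\mathfrak{m}}[X])$. If $\alpha(X)_{\mathfrak{m}} \in H(R_{\mathfrak{m}}[X])$ for every maximal ideal $\mathfrak{m}$ of $R$, then $\alpha(X) \in H(R[X])$. -/

import Mathlib

open scoped Matrix Polynomial

namespace ABCD

/-- Square matrices of size `2n`. The index `(i, k) : Fin n × Fin 2` is the `k`-th row (or column)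
of the `i`-th `2 × 2` block, so a matrix of size `2n` is an `n × n` matrix of `2 × 2` blocks. -/
abbrev Mat (n : ℕ) (R : Type*) := Matrix (Fin n × Fin 2) (Fin n × Fin 2) R

/-- The group `SL_{2n}(R)`. -/
abbrev SL (n : ℕ) (R : Type*) [CommRing R] := Matrix.SpecialLinearGroup (Fin n × Fin 2) R

/-- The standard `2 × 2` alternating matrix of Pfaffian one. -/
def psiOne (R : Type*) [CommRing R] : Matrix (Fin 2) (Fin 2) R := !![0, 1; -1, 0]

/-- The alternating matrix `ψ_n`, with `n` diagonal blocks equal to `ψ_1`. -/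
def psi (n : ℕ) (R : Type*) [CommRing R] : Mat n R :=
  Matrix.of fun p q => if p.1 = q.1 then psiOne R p.2 q.2 else 0

/-- The symplectic group `Sp_{2n}(R) = {α ∈ SL_{2n}(R) | αᵗ ψ_n α = ψ_n}`. -/
def Sp (n : ℕ) (R : Type*) [CommRing R] : Subgroup (SL n R) where
  carrier := {g | (g : Mat n R)ᵀ * psi n R * (g : Mat n R) = psi n R}
  one_mem' := by simp
  mul_mem' := by
    intro g h hg hh
    simp only [Set.mem_ofPred_eq, Matrix.SpecialLinearGroup.coe_mul, Matrix.transpose_mul] at *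
    calc _ = (h : Mat n R)ᵀ * ((g : Mat n R)ᵀ * psi n R * (g : Mat n R)) * (h : Mat n R) := by
          simp only [Matrix.mul_assoc]
      _ = _ := by rw [hg, hh]
  inv_mem' := by
    intro g hg
    simp only [Set.mem_ofPred_eq] at *
    have h1 : (g : Mat n R) * ((g⁻¹ : SL n R) : Mat n R) = 1 := by
      rw [← Matrix.SpecialLinearGroup.coe_mul]; simp
    have h2 : ((g⁻¹ : SL n R) : Mat n R)ᵀ * (g : Mat n R)ᵀ = 1 := by
      rw [← Matrix.transpose_mul, h1, Matrix.transpose_one]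
    calc _ = ((g⁻¹ : SL n R) : Mat n R)ᵀ * ((g : Mat n R)ᵀ * psi n R * (g : Mat n R)) *
            ((g⁻¹ : SL n R) : Mat n R) := by rw [hg]
      _ = (((g⁻¹ : SL n R) : Mat n R)ᵀ * (g : Mat n R)ᵀ) * psi n R *
            ((g : Mat n R) * ((g⁻¹ : SL n R) : Mat n R)) := by simp only [Matrix.mul_assoc]
      _ = _ := by rw [h1, h2]; simp

/-- The block matrix with identity diagonal, first block row `(I, X)` and first block column
`(I, ψ_{n-1} Xᵗ ψ_1)`, where `X` is the row of the `2 × 2` blocks `X i` for `i ≠ 0`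
(the first block is numbered `0`, and the value `X 0` is not used). -/
def E {n : ℕ} {R : Type*} [CommRing R] (X : Fin n → Matrix (Fin 2) (Fin 2) R) : Mat n R :=
  Matrix.of fun p q =>
    (if p.1 = q.1 then (1 : Matrix (Fin 2) (Fin 2) R)
      else if p.1.val = 0 then X q.1
      else if q.1.val = 0 then psiOne R * (X p.1)ᵀ * psiOne R
      else 0) p.2 q.2

section

variable {R : Type*} [CommRing R]

/-- The `2 × 2` matrix of type `A`. -/
def A (a : R) : Matrix (Fin 2) (Fin 2) R := !![a, a; a, a]

/-- The `2 × 2` matrix of type `B`. -/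
def B (b : R) : Matrix (Fin 2) (Fin 2) R := !![b, -b; b, -b]

/-- The `2 × 2` matrix of type `C`. -/
def C (c : R) : Matrix (Fin 2) (Fin 2) R := !![c, c; -c, -c]

/-- The `2 × 2` matrix of type `D`. -/
def D (d : R) : Matrix (Fin 2) (Fin 2) R := !![-d, d; d, -d]

/-- The matrices of type `E(A)`, `E(B)`, `E(C)`, `E(D)`: all the blocks have the same shape,
with arbitrary entries. -/
def IsBasic {n : ℕ} (M : Mat n R) : Prop :=
  ∃ a : Fin n → R,
    M = E (fun i => A (a i)) ∨ M = E (fun i => B (a i)) ∨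
    M = E (fun i => C (a i)) ∨ M = E (fun i => D (a i))

/-- The subgroup `H(R)` generated by the elements of type `E(A)`, `E(B)`, `E(C)`, `E(D)`. -/
def H (n : ℕ) (R : Type*) [CommRing R] : Subgroup (SL n R) :=
  Subgroup.closure {g | IsBasic (g : Mat n R)}

/-- Base change of a matrix in `SL_{2n}(R[X])` to `SL_{2n}(R_𝔪[X])`. -/
noncomputable def localize {n : ℕ} (m : Ideal R) [m.IsPrime] :
    SL n R[X] →* SL n (Localization.AtPrime m)[X] :=
  Matrix.SpecialLinearGroup.map
    (Polynomial.mapRingHom (algebraMap R (Localization.AtPrime m)))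

/-- The specialization `α(X) ↦ α(0)`. -/
noncomputable def evalZero {n : ℕ} : SL n R[X] →* SL n R :=
  Matrix.SpecialLinearGroup.map (Polynomial.evalRingHom (0 : R))

/-! Every matrix of type `E(A)`, `E(B)`, `E(C)`, `E(D)` is symplectic of determinant one, so that
`H(R)` is indeed generated by all of them and lies in `Sp_{2n}(R)`. -/

theorem psiOne_conj (T : Matrix (Fin 2) (Fin 2) R) :
    psiOne R * Tᵀ * psiOne R = -T.adjugate := by
  rw [Matrix.adjugate_fin_two]
  ext p q
  simp only [Matrix.mul_apply, Fin.sum_univ_two, Matrix.transpose_apply, Matrix.neg_apply]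
  fin_cases p <;> fin_cases q <;> simp [psiOne]

theorem block_mul (T : Matrix (Fin 2) (Fin 2) R) (hT : T.det = 0) (x y : R) :
    (x • T) * (psiOne R * (y • T)ᵀ * psiOne R) = 0 ∧
      (psiOne R * (y • T)ᵀ * psiOne R) * (x • T) = 0 := by
  have h := psiOne_conj (y • T)
  rw [h, Matrix.adjugate_smul]
  simp [Matrix.mul_adjugate, Matrix.adjugate_mul, hT]

theorem E_det {n : ℕ} (T : Matrix (Fin 2) (Fin 2) R) (hT : T.det = 0) (a : Fin n → R) :
    (E fun i => a i • T).det = 1 := by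
  cases n with
  | zero => simp
  | succ k =>
    have hb := fun i => (block_mul T hT (a i) (a i)).1
    obtain ⟨Y, hY⟩ : ∃ Y : Fin (k + 1) → Matrix (Fin 2) (Fin 2) R,
        ∀ i, psiOne R * (a i • T)ᵀ * psiOne R = Y i := ⟨_, fun _ => rfl⟩
    obtain ⟨Z, hZ⟩ : ∃ Z : Fin (k + 1) → Matrix (Fin 2) (Fin 2) R,
        ∀ i, a i • T = Z i := ⟨_, fun _ => rfl⟩
    simp only [hZ] at hY
    simp only [hZ, hY] at hb ⊢
    let U : Matrix (Fin (k + 1) × Fin 2) (Fin 2) R :=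
      Matrix.of fun p l => if p.1 = 0 then (1 : Matrix (Fin 2) (Fin 2) R) p.2 l else 0
    let V : Matrix (Fin 2) (Fin (k + 1) × Fin 2) R :=
      Matrix.of fun l q => if q.1 = 0 then 0 else Z q.1 l q.2
    let U' : Matrix (Fin (k + 1) × Fin 2) (Fin 2) R :=
      Matrix.of fun p l => if p.1 = 0 then 0 else Y p.1 p.2 l
    let V' : Matrix (Fin 2) (Fin (k + 1) × Fin 2) R :=
      Matrix.of fun l q => if q.1 = 0 then (1 : Matrix (Fin 2) (Fin 2) R) l q.2 else 0
    have hVU : V * U = 0 := by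
      ext i j
      simp [V, U, Matrix.mul_apply, Fintype.sum_prod_type, Fin.sum_univ_succ]
    have hVU' : V' * U' = 0 := by
      ext i j
      simp [V', U', Matrix.mul_apply, Fintype.sum_prod_type, Fin.sum_univ_succ]
    have hX : V * U' = 0 := by
      ext i j
      simp only [V, U', Matrix.mul_apply, Fintype.sum_prod_type]
      refine Finset.sum_eq_zero fun x _ => ?_
      by_cases hx : x = 0
      · simp [hx]
      · have h := congrFun (congrFun (hb x) i) j
        rw [Matrix.mul_apply] at h
        simpa [hx] using h
    have hE : (E fun i => Z i) = (1 + U * V) * (1 + U' * V') := by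
      have h0 : U * V * (U' * V') = 0 := by
        rw [Matrix.mul_assoc, ← Matrix.mul_assoc V, hX]; simp
      rw [mul_add, add_mul, add_mul, h0]
      ext ⟨i, p⟩ ⟨j, q⟩
      clear hVU hVU' hX h0
      by_cases hi : i = 0 <;> by_cases hj : j = 0 <;> by_cases hij : i = j <;>
        simp_all [E, U, V, U', V', Matrix.mul_apply, Matrix.one_apply]
    rw [hE, Matrix.det_mul, Matrix.det_one_add_mul_comm, hVU, Matrix.det_one_add_mul_comm, hVU']
    simp

theorem E_symp {n : ℕ} (T : Matrix (Fin 2) (Fin 2) R) (hT : T.det = 0) (a : Fin n → R) :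
    (E fun i => a i • T)ᵀ * psi n R * (E fun i => a i • T) = psi n R := by
  let b : Fin n → Fin n → Matrix (Fin 2) (Fin 2) R := fun i j =>
    if i = j then 0 else if i.val = 0 then a j • T
      else if j.val = 0 then psiOne R * (a i • T)ᵀ * psiOne R else 0
  have hb : ∀ i j k, b i j * b j k = 0 := by
    intro i j k
    simp only [b]
    split_ifs <;> first
      | exact mul_zero _
      | exact zero_mul _
      | exact (block_mul T hT _ _).1
      | exact (block_mul T hT _ _).2
      | (exfalso; omega)
  let N : Mat n R := Matrix.of fun p q => b p.1 q.1 p.2 q.2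
  have hE : (E fun i => a i • T) = 1 + N := by
    ext ⟨i, p⟩ ⟨j, q⟩
    by_cases hij : i = j <;> simp [E, N, b, hij, Matrix.one_apply]
  have hN : N * N = 0 := by
    ext ⟨i, p⟩ ⟨k, q⟩
    simp only [N, Matrix.mul_apply, Fintype.sum_prod_type, Matrix.of_apply]
    refine Finset.sum_eq_zero fun j _ => ?_
    rw [← Matrix.mul_apply, hb]; simp
  have hp : psiOne R * psiOne R = -1 := by
    ext p q
    fin_cases p <;> fin_cases q <;> simp [psiOne]
  have hpt : (psiOne R)ᵀ = -psiOne R := by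
    ext p q
    fin_cases p <;> fin_cases q <;> simp [psiOne]
  have hw1 (W : Matrix (Fin 2) (Fin 2) R) :
      Wᵀ * psiOne R = -(psiOne R * (psiOne R * Wᵀ * psiOne R)) := by
    rw [Matrix.mul_assoc (psiOne R) Wᵀ, ← Matrix.mul_assoc (psiOne R) (psiOne R), hp]
    simp
  have hw2 (W : Matrix (Fin 2) (Fin 2) R) :
      (psiOne R * Wᵀ * psiOne R)ᵀ * psiOne R = -(psiOne R * W) := by
    rw [Matrix.transpose_mul, Matrix.transpose_mul, Matrix.transpose_transpose, hpt]
    simp [Matrix.mul_assoc, hp]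
  have hs : Nᵀ * psi n R = - (psi n R * N) := by
    ext ⟨i, p⟩ ⟨j, q⟩
    have h : (b j i)ᵀ * psiOne R = - (psiOne R * b i j) := by
      simp only [b]
      split_ifs <;> first
        | omega
        | exact hw1 _
        | exact hw2 _
        | simp
    have h := congrFun (congrFun h p) q
    simp only [Matrix.mul_apply, Matrix.neg_apply, Matrix.transpose_apply] at h
    have e1 : (Nᵀ * psi n R) (i, p) (j, q) = ∑ l, b j i l p * psiOne R l q := by
      simp only [N, psi, Matrix.mul_apply, Fintype.sum_prod_type, Matrix.transpose_apply,
        Matrix.of_apply, mul_ite, mul_zero]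
      rw [Finset.sum_eq_single j] <;> simp +contextual
    have e2 : (psi n R * N) (i, p) (j, q) = ∑ l, psiOne R p l * b i j l q := by
      simp only [N, psi, Matrix.mul_apply, Fintype.sum_prod_type,
        Matrix.of_apply, ite_mul, zero_mul]
      rw [Finset.sum_eq_single i] <;> simp +contextual [eq_comm]
    rw [Matrix.neg_apply, e1, e2, h]
  rw [hE, Matrix.transpose_add, Matrix.transpose_one, add_mul, one_mul, hs, mul_add, mul_one,
    add_mul, neg_mul, Matrix.mul_assoc, hN]
  simp

theorem IsBasic.det_and_symp {n : ℕ} {M : Mat n R} (hM : IsBasic M) :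
    M.det = 1 ∧ Mᵀ * psi n R * M = psi n R := by
  have key : ∀ (T : Matrix (Fin 2) (Fin 2) R) (F : R → Matrix (Fin 2) (Fin 2) R) (a : Fin n → R),
      T.det = 0 → (∀ x, F x = x • T) → M = E (fun i => F (a i)) →
      M.det = 1 ∧ Mᵀ * psi n R * M = psi n R := by
    intro T F a hT hF h
    simp only [hF] at h
    subst h
    exact ⟨E_det T hT a, E_symp T hT a⟩
  obtain ⟨a, h | h | h | h⟩ := hM
  · exact key !![1, 1; 1, 1] A a (by simp [Matrix.det_fin_two]) (by intro x; simp [A]) h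
  · exact key !![1, -1; 1, -1] B a (by simp [Matrix.det_fin_two]) (by intro x; simp [B]) h
  · exact key !![1, 1; -1, -1] C a (by simp [Matrix.det_fin_two]) (by intro x; simp [C]) h
  · exact key !![-1, 1; 1, -1] D a (by simp [Matrix.det_fin_two]) (by intro x; simp [D]) h

theorem H_le_Sp (n : ℕ) : H n R ≤ Sp n R :=
  (Subgroup.closure_le _).2 fun _ hg => (IsBasic.det_and_symp hg).2

end

end ABCD

/-!
If `2` is invertible, the vectors `(1, 1)` and `(1, -1)` form a basis of each block, and the given
generators are products of maps `x ↦ x + a (⟨v, x⟩ u + ⟨u, x⟩ v)` (here `transv u v a`), where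
`u` is such a vector in the first block and `v` such a vector in another one. For at least two
blocks, commutators of these give all elementary symplectic matrices, so that the claim is Quillen's
local global principle for the elementary symplectic group.

The heart is that conjugation is continuous (`exists_conj_mem_congruenceMonoid`). Let `Q` be the
localization of `P` at a multiplicative set `S`. For `h` symplectic over `Q` and `s ∈ S` there is a
`t ∈ S` such that `h` conjugates the generators with parameters in `t P` into the monoid generated by
those with parameters in `s P`. As `h` conjugates `transv u v a` into `transv (h u) (h v) a`, it
suffices that `transv u v a` lies in the latter monoid whenever `⟨u, v⟩ = 0` and `a ∈ t P`, for some
`t` that depends on `u` and `v`; this is `isSmall_transv`. It follows from two identities. The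
commutator of `transv p x b` and `transv q y c`, with `x` and `y` orthogonal to each other and to
`p` and `q`, is `transv x y (b c ⟨p, q⟩)`; and `transv p w a` is additive in `p ∈ w^⊥` up to a
transvection in the direction `w`. So one gets from the generators to basis vectors, from these to the
transvections in any direction `v` that vanishes on some block, and then to all `v`.

Consequently, writing the localized `α` as a product of generators, `α(Y + t Z) α(Y)⁻¹` has no
denominators for a suitable `t ∉ 𝔪` (`exists_subst_mem_congruenceMonoid`): it agrees with an
element of `H(R[Y, Z])` in the localization. After a further substitution `Z ↦ s Z` the
two are equal up to a factor in `H` (`map_comp_eq_of_smul_eq`). Thus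
`α((d + s c) X) α(d X)⁻¹ ∈ H(R[X])` for some `s ∉ 𝔪` and all `d`, `c`. The `s` with this property
form an ideal, which therefore contains `1`.
-/

namespace ABCD

/-! ### Symplectic transvections -/

section Transvections

variable {n : ℕ} {K : Type*} [CommRing K]

/-- The symplectic form `⟨u, v⟩ = uᵗ ψ_n v`. -/
noncomputable def form (n : ℕ) (K : Type*) [CommRing K] :
    LinearMap.BilinForm K (Fin n × Fin 2 → K) :=
  Matrix.toBilin' (psi n K)

theorem form_apply (u v : Fin n × Fin 2 → K) :
    form n K u v = ∑ i, (u (i, 0) * v (i, 1) - u (i, 1) * v (i, 0)) := by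
  rw [form, Matrix.toBilin'_apply', dotProduct, Fintype.sum_prod_type]
  refine Finset.sum_congr rfl fun i _ => ?_
  simp [Matrix.mulVec, dotProduct, psi, psiOne, Fintype.sum_prod_type, Fin.sum_univ_two]
  ring

theorem form_self (u : Fin n × Fin 2 → K) : form n K u u = 0 := by
  rw [form_apply]
  exact Finset.sum_eq_zero fun i _ => by ring

theorem form_swap (u v : Fin n × Fin 2 → K) : form n K v u = -form n K u v := by
  rw [form_apply, form_apply, ← Finset.sum_neg_distrib]
  exact Finset.sum_congr rfl fun i _ => by ring

theorem form_swap_zero {u v : Fin n × Fin 2 → K} (h : form n K u v = 0) :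
    form n K v u = 0 := by
  rw [form_swap, h, neg_zero]

/-- The matrix of `x ↦ x + a (⟨v, x⟩ u + ⟨u, x⟩ v)`. For `⟨u, v⟩ = 0` it is symplectic, and
`transv u u a` is the symplectic transvection `x ↦ x + 2a ⟨u, x⟩ u`. -/
def transv (u v : Fin n × Fin 2 → K) (a : K) : Mat n K :=
  1 + a • (Matrix.vecMulVec u (v ᵥ* psi n K) + Matrix.vecMulVec v (u ᵥ* psi n K))

theorem transv_mulVec (u v : Fin n × Fin 2 → K) (a : K) (x : Fin n × Fin 2 → K) :
    transv u v a *ᵥ x = x + a • (form n K v x • u + form n K u x • v) := by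
  have h (w z : Fin n × Fin 2 → K) :
      Matrix.vecMulVec w (z ᵥ* psi n K) *ᵥ x = form n K z x • w := by
    rw [Matrix.vecMulVec_mulVec, form, Matrix.toBilin'_apply', Matrix.dotProduct_mulVec]
    simp
  rw [transv, Matrix.add_mulVec, Matrix.one_mulVec, Matrix.smul_mulVec, Matrix.add_mulVec, h, h]

theorem mat_ext {M N : Mat n K} (h : ∀ x, M *ᵥ x = N *ᵥ x) : M = N :=
  Matrix.toLin'.injective (LinearMap.ext fun x => by simpa using h x)

theorem transv_symm (u v : Fin n × Fin 2 → K) (a : K) : transv u v a = transv v u a := by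
  rw [transv, transv, add_comm (Matrix.vecMulVec u _)]

theorem transv_zero (u v : Fin n × Fin 2 → K) : transv u v 0 = 1 := by
  simp [transv]

theorem transv_zero_left (v : Fin n × Fin 2 → K) (a : K) : transv 0 v a = 1 := by
  simp [transv]

theorem transv_smul_left (c : K) (u v : Fin n × Fin 2 → K) (a : K) :
    transv (c • u) v a = transv u v (c * a) := by
  refine mat_ext fun x => ?_
  simp only [transv_mulVec, map_smul, LinearMap.smul_apply, smul_eq_mul]
  module

/-- On the vectors orthogonal to `w`, the map `p ↦ transv p w a` is additive up to a transvection in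
the direction `w`. -/
theorem transv_add_left {p q w : Fin n × Fin 2 → K} (hp : form n K p w = 0)
    (hq : form n K q w = 0) (a b : K) (hb : 2 * b = -(form n K p q * a ^ 2)) :
    transv (p + q) w a = transv p w a * transv q w a * transv w w b := by
  refine mat_ext fun x => ?_
  simp only [← Matrix.mulVec_mulVec, transv_mulVec, map_add, map_smul, LinearMap.add_apply,
    smul_eq_mul, hp, hq, form_self, form_swap_zero hq]
  have hb' : (2 * b) • w = (-(form n K p q * a ^ 2)) • w := by rw [hb]
  linear_combination (norm := module) (-(form n K w x)) • hb'

theorem transv_add_left_of_orthogonal {p q w : Fin n × Fin 2 → K} (hp : form n K p w = 0)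
    (hq : form n K q w = 0) (hpq : form n K p q = 0) (a : K) :
    transv (p + q) w a = transv p w a * transv q w a := by
  rw [transv_add_left hp hq a 0 (by simp [hpq]), transv_zero, mul_one]

theorem transv_mul_transv {u v : Fin n × Fin 2 → K} (h : form n K u v = 0) (a b : K) :
    transv u v a * transv u v b = transv u v (a + b) := by
  have h' := transv_add_left_of_orthogonal (p := a • u) (q := b • u) (w := v)
    (by simp [h]) (by simp [h]) (by simp [form_self]) 1
  rw [← add_smul, transv_smul_left, transv_smul_left, transv_smul_left] at h'
  simpa using h'.symm

/-- The left side is a commutator, as `transv p x (-b)` is the inverse of `transv p x b`. -/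
theorem transv_commutator {p q x y : Fin n × Fin 2 → K} (hpx : form n K p x = 0)
    (hpy : form n K p y = 0) (hqx : form n K q x = 0) (hqy : form n K q y = 0)
    (hxy : form n K x y = 0) (b c : K) :
    transv p x b * transv q y c * transv p x (-b) * transv q y (-c) =
      transv x y (b * c * form n K p q) := by
  refine mat_ext fun z => ?_
  simp only [← Matrix.mulVec_mulVec, transv_mulVec, map_add, map_smul, smul_eq_mul, hpx,
    hpy, hqx, hqy, hxy, form_self, form_swap_zero hpx, form_swap_zero hpy,
    form_swap_zero hqx, form_swap_zero hqy, form_swap_zero hxy, form_swap p q]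
  module

theorem transv_add_add {u v : Fin n × Fin 2 → K} (h : form n K u v = 0) (a : K) :
    transv (u + v) (u + v) a = transv u u a * transv v v a * transv u v (2 * a) := by
  refine mat_ext fun z => ?_
  simp only [← Matrix.mulVec_mulVec, transv_mulVec, map_add, map_smul, LinearMap.add_apply,
    smul_eq_mul, h, form_self, form_swap_zero h]
  module

theorem form_mulVec {h : Mat n K} (hh : hᵀ * psi n K * h = psi n K) (u v : Fin n × Fin 2 → K) :
    form n K (h *ᵥ u) (h *ᵥ v) = form n K u v := by
  simp only [form, Matrix.toBilin'_apply']
  conv_rhs => rw [← hh]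
  rw [Matrix.mul_assoc, ← Matrix.mulVec_mulVec, ← Matrix.mulVec_mulVec,
    Matrix.dotProduct_mulVec u, Matrix.vecMul_transpose]

theorem conj_transv {h h' : Mat n K} (hh : hᵀ * psi n K * h = psi n K) (hi : h * h' = 1)
    (u v : Fin n × Fin 2 → K) (a : K) :
    h * transv u v a * h' = transv (h *ᵥ u) (h *ᵥ v) a := by
  refine mat_ext fun x => ?_
  obtain ⟨y, rfl⟩ : ∃ y, x = h *ᵥ y := ⟨h' *ᵥ x, by simp [hi]⟩
  have hi' : h' * h = 1 := mul_eq_one_comm.1 hi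
  simp only [← Matrix.mulVec_mulVec, transv_mulVec, form_mulVec hh]
  rw [Matrix.mulVec_mulVec _ h' h, hi', Matrix.one_mulVec]
  simp [Matrix.mulVec_add, Matrix.mulVec_smul]

end Transvections

/-! ### The generators as transvections -/

section Roots

variable {K : Type*} [CommRing K]

/-- The vector with the entries `(1, ε)` in the block `i` and zero elsewhere, for a sign `ε`. If `2`
is invertible, the two signs give a basis of the block, and `A(a)`, `B(a)`, `C(a)`, `D(a)` are
products of a column and a row of this kind. -/
def blockVec {n : ℕ} (i : Fin n) (ε : ℤˣ) : Fin n × Fin 2 → K :=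
  fun p => if p.1 = i then ![1, ((ε : ℤ) : K)] p.2 else 0

theorem form_blockVec {n : ℕ} (u : Fin n × Fin 2 → K) (i : Fin n) (ε : ℤˣ) :
    form n K u (blockVec i ε) = u (i, 0) * ((ε : ℤ) : K) - u (i, 1) := by
  rw [form_apply, Finset.sum_eq_single i] <;> simp +contextual [blockVec]

theorem unit_mul_self (ε : ℤˣ) : ((ε : ℤ) : K) * ((ε : ℤ) : K) = 1 := by
  rw [← Int.cast_mul, ← Units.val_mul, Int.units_mul_self]; simp

/-- The matrix `E(Y(a_2), …, Y(a_n))`, where `Y(a)` is the product of the column `a (1, ε)` and the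
row `(1, δ)`. The four choices of the signs give the types `A`, `B`, `C` and, after a change of
sign of `a`, `D`. -/
def root {n : ℕ} (ε δ : ℤˣ) (a : Fin n → K) : Mat n K :=
  E fun i => a i • Matrix.vecMulVec ![1, ((ε : ℤ) : K)] ![1, ((δ : ℤ) : K)]

theorem isBasic_iff {n : ℕ} {M : Mat n K} :
    IsBasic M ↔ ∃ (ε δ : ℤˣ) (a : Fin n → K), M = root ε δ a := by
  have hA (x : K) : A x = x • Matrix.vecMulVec ![1, (((1 : ℤˣ) : ℤ) : K)]
      ![1, (((1 : ℤˣ) : ℤ) : K)] := by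
    ext i j; fin_cases i <;> fin_cases j <;> simp [A]
  have hB (x : K) : B x = x • Matrix.vecMulVec ![1, (((1 : ℤˣ) : ℤ) : K)]
      ![1, (((-1 : ℤˣ) : ℤ) : K)] := by
    ext i j; fin_cases i <;> fin_cases j <;> simp [B]
  have hC (x : K) : C x = x • Matrix.vecMulVec ![1, (((-1 : ℤˣ) : ℤ) : K)]
      ![1, (((1 : ℤˣ) : ℤ) : K)] := by
    ext i j; fin_cases i <;> fin_cases j <;> simp [C]
  have hD (x : K) : D x = (-x) • Matrix.vecMulVec ![1, (((-1 : ℤˣ) : ℤ) : K)]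
      ![1, (((-1 : ℤˣ) : ℤ) : K)] := by
    ext i j; fin_cases i <;> fin_cases j <;> simp [D]
  constructor
  · rintro ⟨a, h | h | h | h⟩
    · exact ⟨1, 1, a, by simp only [h, root, hA]⟩
    · exact ⟨1, -1, a, by simp only [h, root, hB]⟩
    · exact ⟨-1, 1, a, by simp only [h, root, hC]⟩
    · exact ⟨-1, -1, -a, by simp only [h, root, hD, Pi.neg_apply]⟩
  · rintro ⟨ε, δ, a, rfl⟩
    rcases Int.units_eq_one_or ε with rfl | rfl <;> rcases Int.units_eq_one_or δ with rfl | rfl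
    · exact ⟨a, Or.inl (by simp only [root, hA])⟩
    · exact ⟨a, Or.inr (Or.inl (by simp only [root, hB]))⟩
    · exact ⟨a, Or.inr (Or.inr (Or.inl (by simp only [root, hC])))⟩
    · exact ⟨-a, Or.inr (Or.inr (Or.inr (by simp only [root, hD, Pi.neg_apply, neg_neg])))⟩

/-- The vector on the left is the sum of the `δ a_i` times `blockVec i (-δ)` for `i ≠ 0`: the row
`(1, δ)` is the functional given by pairing with `δ (1, -δ)`. -/
theorem root_eq_transv {n : ℕ} (ε δ : ℤˣ) (a : Fin (n + 1) → K) :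
    root ε δ a = transv (fun p => if p.1 = 0 then 0 else ((δ : ℤ) : K) * a p.1 *
      ![1, (((-δ : ℤˣ) : ℤ) : K)] p.2) (blockVec 0 ε) 1 := by
  have hv (w : Fin (n + 1) × Fin 2 → K) (j : Fin (n + 1)) (l : Fin 2) :
      (w ᵥ* psi (n + 1) K) (j, l) = ![-w (j, 1), w (j, 0)] l := by
    rw [Matrix.vecMul, dotProduct, Fintype.sum_prod_type, Finset.sum_eq_single j]
    · fin_cases l <;> simp [psi, psiOne]
    · intro b _ hb
      simp [psi, hb]
    · simp
  have hδ := unit_mul_self (K := K) δ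
  ext ⟨i, k⟩ ⟨j, l⟩
  simp only [transv, Matrix.add_apply, Matrix.smul_apply, Matrix.vecMulVec_apply, hv, root, E,
    Matrix.of_apply, blockVec, Matrix.one_apply, Prod.mk.injEq, psiOne_conj,
    Matrix.adjugate_fin_two]
  clear hv
  by_cases hi : i = 0 <;> by_cases hj : j = 0 <;> by_cases hij : i = j <;>
    fin_cases k <;> fin_cases l <;> simp_all <;> grind

end Roots

section RootAddition

variable {K : Type*} [CommRing K]

theorem root_zero {n : ℕ} (ε δ : ℤˣ) : root ε δ (0 : Fin n → K) = 1 := by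
  cases n with
  | zero => exact Subsingleton.elim _ _
  | succ n =>
    rw [root_eq_transv]
    convert transv_zero_left _ _ using 2
    ext p
    simp

theorem root_add {n : ℕ} (ε δ : ℤˣ) (a b : Fin n → K) :
    root ε δ (a + b) = root ε δ a * root ε δ b := by
  cases n with
  | zero => exact Subsingleton.elim _ _
  | succ n =>
    simp only [root_eq_transv]
    rw [← transv_add_left_of_orthogonal]
    · congr 1
      ext p
      by_cases hp : p.1 = 0 <;> simp [hp]
      ring
    · simp [form_blockVec]
    · simp [form_blockVec]
    · rw [form_apply]
      refine Finset.sum_eq_zero fun i _ => ?_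
      by_cases hi : i = 0 <;> simp [hi]
      ring

theorem root_single {n : ℕ} (ε δ : ℤˣ) {i : Fin (n + 1)} (hi : i ≠ 0) (a : K) :
    root ε δ (Pi.single i a) =
      transv (blockVec 0 ε) (blockVec i (-δ)) (((δ : ℤ) : K) * a) := by
  rw [root_eq_transv, transv_symm (blockVec 0 ε), ← mul_one (((δ : ℤ) : K) * a),
    ← transv_smul_left]
  congr 1
  ext p
  by_cases hp : p.1 = i
  · simp [hp, hi, blockVec]
  · simp [hp, blockVec]

theorem root_of_subsingleton {n : ℕ} [Subsingleton (Fin n)] (ε δ : ℤˣ) (a : Fin n → K) :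
    root ε δ a = 1 := by
  ext ⟨i, k⟩ ⟨j, l⟩
  obtain rfl := Subsingleton.elim i j
  simp [root, E, Matrix.one_apply]

theorem map_root {n : ℕ} {K' : Type*} [CommRing K'] (f : K →+* K') (ε δ : ℤˣ) (a : Fin n → K) :
    (root ε δ a).map f = root ε δ (f ∘ a) := by
  cases n with
  | zero => exact Subsingleton.elim _ _
  | succ n =>
    ext ⟨i, k⟩ ⟨j, l⟩
    simp only [root, E, psiOne_conj, Matrix.adjugate_fin_two, Matrix.map_apply, Matrix.of_apply]
    by_cases hi : i = 0 <;> by_cases hj : j = 0 <;> by_cases hij : i = j <;>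
      fin_cases k <;> fin_cases l <;> simp_all

end RootAddition

/-! ### Congruence monoids and small families -/

section Small

variable {R P Q : Type*} [CommRing R] [CommRing P] [CommRing Q] [Algebra R P] [Algebra R Q]
variable {n : ℕ}

/-- The monoid of matrices over `Q` generated by the `E(Y(a_2), …, Y(a_n))` whose parameters `a_i`
come from the ideal `s P` of `P`. For `s` running through a multiplicative set, these monoids play
the role of a basis of neighbourhoods of one. -/
def congruenceMonoid (n : ℕ) (φ : P →ₐ[R] Q) (s : R) : Submonoid (Mat n Q) :=
  Submonoid.closure {M | ∃ (ε δ : ℤˣ) (a : Fin n → P), M = root ε δ fun i => φ (s • a i)}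

/-- A family of matrices with a parameter in `Q` is small if it is continuous at zero, with value
one, for the topologies given by the ideals `s P` and the monoids `congruenceMonoid n φ s`. -/
def IsSmall (S : Submonoid R) (φ : P →ₐ[R] Q) (F : Q → Mat n Q) : Prop :=
  ∀ s ∈ S, ∃ t ∈ S, ∀ a : P, F (φ (t • a)) ∈ congruenceMonoid n φ s

variable {S : Submonoid R} {φ : P →ₐ[R] Q}

theorem IsSmall.one : IsSmall S φ fun _ => (1 : Mat n Q) :=
  fun s hs => ⟨s, hs, fun _ => one_mem _⟩

theorem IsSmall.mul {F G : Q → Mat n Q} (hF : IsSmall S φ F) (hG : IsSmall S φ G) :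
    IsSmall S φ fun x => F x * G x := by
  intro s hs
  obtain ⟨t, ht, h1⟩ := hF s hs
  obtain ⟨u, hu, h2⟩ := hG s hs
  refine ⟨t * u, S.mul_mem ht hu, fun a => mul_mem ?_ ?_⟩
  · rw [mul_smul]; exact h1 _
  · rw [mul_comm, mul_smul]; exact h2 _

theorem IsSmall.comp {F : Q → Mat n Q} (hφ : ∀ x : Q, ∃ s ∈ S, ∃ p : P, s • x = φ p)
    (hF : IsSmall S φ F) (c : Q) (k : ℕ) : IsSmall S φ fun x => F (c * x ^ (k + 1)) := by
  intro s hs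
  obtain ⟨t, ht, h1⟩ := hF s hs
  obtain ⟨u, hu, p, hp⟩ := hφ c
  refine ⟨t * u, S.mul_mem ht hu, fun a => ?_⟩
  have : c * φ ((t * u) • a) ^ (k + 1) = φ (t • (p * (a * ((t * u) • a) ^ k))) := by
    rw [pow_succ', map_smul φ t, map_mul φ p, ← hp, map_mul φ a, map_pow]
    conv_lhs => rw [map_smul, mul_smul]
    simp only [smul_mul_assoc, mul_smul_comm, map_smul, mul_smul]
  simp only [this]
  exact h1 _

theorem IsSmall.comp_mul {F : Q → Mat n Q} (hφ : ∀ x : Q, ∃ s ∈ S, ∃ p : P, s • x = φ p)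
    (hF : IsSmall S φ F) (c : Q) : IsSmall S φ fun x => F (c * x) := by
  simpa using hF.comp hφ c 0

/-- The commutator of two small families is small in the product of the parameters: an element of
`s t P` is the product of `s` and an element of `t P`. -/
theorem IsSmall.transv_of_commutator (hφ : ∀ x : Q, ∃ s ∈ S, ∃ p : P, s • x = φ p)
    {p q x y : Fin n × Fin 2 → Q} (hpq : IsUnit (form n Q p q)) (hpx : form n Q p x = 0)
    (hpy : form n Q p y = 0) (hqx : form n Q q x = 0) (hqy : form n Q q y = 0)
    (hxy : form n Q x y = 0) (h1 : IsSmall S φ (transv p x)) (h2 : IsSmall S φ (transv q y)) :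
    IsSmall S φ (transv x y) := by
  obtain ⟨μ, hμ⟩ := hpq.exists_right_inv
  intro s hs
  obtain ⟨t, ht, h1⟩ := h1 s hs
  obtain ⟨u, hu, h2⟩ := h2.comp_mul hφ μ s hs
  refine ⟨t * u, S.mul_mem ht hu, fun a => ?_⟩
  have e : φ ((t * u) • a) = φ (t • 1) * (μ * φ (u • a)) * form n Q p q := by
    calc φ ((t * u) • a) = (t • u • φ a) * (form n Q p q * μ) := by
          rw [hμ, mul_one, mul_smul, map_smul, map_smul]
      _ = _ := by
          rw [map_smul, map_smul, map_one]
          simp only [Algebra.smul_def]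
          ring
  rw [e, ← transv_commutator hpx hpy hqx hqy hxy]
  have h3 := h1 (-1)
  have h4 := h2 (-a)
  rw [smul_neg, map_neg] at h3 h4
  simp only [mul_neg] at h4
  exact mul_mem (mul_mem (mul_mem (h1 1) (h2 a)) h3) h4

/-- For a small transvection in the direction `w`, the vectors `p` orthogonal to `w` with
`transv p w` small. -/
def smallSubmodule (hφ : ∀ x : Q, ∃ s ∈ S, ∃ p : P, s • x = φ p) (h2 : IsUnit (2 : Q))
    (w : Fin n × Fin 2 → Q) (hw : IsSmall S φ (transv w w)) :
    Submodule Q (Fin n × Fin 2 → Q) where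
  carrier := {p | form n Q p w = 0 ∧ IsSmall S φ (transv p w)}
  zero_mem' := ⟨by simp, by
    have : transv (0 : Fin n × Fin 2 → Q) w = fun _ => 1 := funext fun a => transv_zero_left w a
    rw [this]; exact IsSmall.one⟩
  add_mem' := by
    rintro p q ⟨hp, hps⟩ ⟨hq, hqs⟩
    refine ⟨by simp [hp, hq], ?_⟩
    obtain ⟨c, hc⟩ := h2.exists_right_inv
    have h := (hps.mul hqs).mul (hw.comp hφ (-(c * form n Q p q)) 1)
    convert h using 2 with a
    refine transv_add_left hp hq a _ ?_
    linear_combination (-(form n Q p q) * a ^ 2) * hc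
  smul_mem' := by
    rintro c p ⟨hp, hps⟩
    refine ⟨by simp [hp], ?_⟩
    have : transv (c • p) w = fun x => transv p w (c * x) :=
      funext fun x => transv_smul_left c p w x
    rw [this]
    exact hps.comp_mul hφ c

/-- A vector lies in any submodule that contains the block vectors of the blocks where it does
not vanish. -/
theorem mem_of_blockVec_mem (h2 : IsUnit (2 : Q)) (V : Submodule Q (Fin n × Fin 2 → Q))
    (v : Fin n × Fin 2 → Q)
    (h : ∀ i, (∀ ε, blockVec i ε ∈ V) ∨ ∀ k, v (i, k) = 0) : v ∈ V := by
  obtain ⟨c, hc⟩ := h2.exists_right_inv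
  have hv : v = ∑ i, ((c * (v (i, 0) + v (i, 1))) • blockVec i 1 +
      (c * (v (i, 0) - v (i, 1))) • blockVec i (-1)) := by
    ext ⟨j, k⟩
    rw [Finset.sum_apply, Finset.sum_eq_single j]
    · fin_cases k <;> simp [blockVec]
      · linear_combination (-v (j, 0)) * hc
      · linear_combination (-v (j, 1)) * hc
    · intro b _ hb
      simp [blockVec, hb.symm]
    · simp
  rw [hv]
  refine sum_mem fun i _ => ?_
  rcases h i with h | h
  · exact add_mem (V.smul_mem _ (h _)) (V.smul_mem _ (h _))
  · simp [h]

end Small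

/-! ### Continuity of conjugation -/

section Orthogonal

variable {R P Q : Type*} [CommRing R] [CommRing P] [CommRing Q] [Algebra R P] [Algebra R Q]
variable {n : ℕ} {S : Submonoid R} {φ : P →ₐ[R] Q}

theorem form_blockVec_ne {i j : Fin n} (h : i ≠ j) (ε δ : ℤˣ) :
    form n Q (blockVec i ε) (blockVec j δ) = 0 := by
  rw [form_blockVec]
  simp [blockVec, h.symm]

theorem form_blockVec_of_zero {v : Fin n × Fin 2 → Q} {j : Fin n} (h : ∀ k, v (j, k) = 0)
    (ε : ℤˣ) : form n Q v (blockVec j ε) = 0 := by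
  rw [form_blockVec, h, h]; simp

theorem isUnit_form_blockVec (h2 : IsUnit (2 : Q)) (i : Fin n) :
    IsUnit (form n Q (blockVec i 1) (blockVec i (-1))) := by
  rw [form_blockVec]
  have : (blockVec i 1 : Fin n × Fin 2 → Q) (i, 0) * (((-1 : ℤˣ) : ℤ) : Q) -
      (blockVec i 1 : Fin n × Fin 2 → Q) (i, 1) = -2 := by
    simp [blockVec]; norm_num
  rw [this]
  exact h2.neg

/-- These are the generators with a single nonzero parameter. -/
theorem isSmall_transv_zero_block (hφ : ∀ x : Q, ∃ s ∈ S, ∃ p : P, s • x = φ p)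
    {i : Fin (n + 1)} (hi : i ≠ 0) (ε δ : ℤˣ) :
    IsSmall S φ (transv (blockVec 0 ε) (blockVec i δ)) := by
  have h : IsSmall S φ fun a => root ε (-δ) (Pi.single i a) := by
    intro s hs
    refine ⟨s, hs, fun a => Submonoid.subset_closure ?_⟩
    have e : (Pi.single i (φ (s • a)) : Fin (n + 1) → Q) =
        fun j => φ (s • (Pi.single i a : Fin (n + 1) → P) j) := by
      ext j
      by_cases hj : j = i
      · subst hj; simp
      · simp [hj]
    exact ⟨ε, -δ, Pi.single i a, congrArg (root ε (-δ)) e⟩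
  have h := h.comp_mul hφ (((-δ : ℤˣ) : ℤ) : Q)
  simp only [root_single _ _ hi, neg_neg, ← mul_assoc, unit_mul_self, one_mul] at h
  exact h

/-- If exactly one of `i` and `j` is the first block, this is a generator. Otherwise some block `o`,
different from both, is joined to them by generators, and a commutator of these is used. -/
theorem isSmall_transv_blockVec (hφ : ∀ x : Q, ∃ s ∈ S, ∃ p : P, s • x = φ p)
    (h2 : IsUnit (2 : Q)) (i j : Fin (n + 2)) (ε δ : ℤˣ)
    (h : form (n + 2) Q (blockVec i ε) (blockVec j δ) = 0) :
    IsSmall S φ (transv (blockVec i ε) (blockVec j δ)) := by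
  have key (o : Fin (n + 2)) (hi : i ≠ o) (hj : j ≠ o)
      (h1 : IsSmall S φ (transv (blockVec o 1) (blockVec i ε)))
      (h3 : IsSmall S φ (transv (blockVec o (-1)) (blockVec j δ))) :
      IsSmall S φ (transv (blockVec i ε) (blockVec j δ)) :=
    IsSmall.transv_of_commutator hφ (isUnit_form_blockVec h2 o) (form_blockVec_ne hi.symm _ _)
      (form_blockVec_ne hj.symm _ _) (form_blockVec_ne hi.symm _ _) (form_blockVec_ne hj.symm _ _)
      h h1 h3
  have symm (u v : Fin (n + 2) × Fin 2 → Q) (h : IsSmall S φ (transv u v)) :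
      IsSmall S φ (transv v u) := by
    rwa [show transv v u = transv u v from funext fun a => transv_symm v u a]
  by_cases hi : i = 0 <;> by_cases hj : j = 0
  · subst hi hj
    have h10 : (1 : Fin (n + 2)) ≠ 0 := by simp
    exact key 1 h10.symm h10.symm (symm _ _ (isSmall_transv_zero_block hφ h10 _ _))
      (symm _ _ (isSmall_transv_zero_block hφ h10 _ _))
  · subst hi
    exact isSmall_transv_zero_block hφ hj _ _
  · subst hj
    exact symm _ _ (isSmall_transv_zero_block hφ hi _ _)
  · exact key 0 hi hj (isSmall_transv_zero_block hφ hi _ _) (isSmall_transv_zero_block hφ hj _ _)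

/-- The transvection in the direction `v` is a commutator of transvections that involve the two
basis vectors of the block `j`, to which `v` is orthogonal. -/
theorem isSmall_transv_self_of_zero (hφ : ∀ x : Q, ∃ s ∈ S, ∃ p : P, s • x = φ p)
    (h2 : IsUnit (2 : Q)) {v : Fin (n + 2) × Fin 2 → Q} {j : Fin (n + 2)}
    (hv : ∀ k, v (j, k) = 0) : IsSmall S φ (transv v v) := by
  have h (ε : ℤˣ) : IsSmall S φ (transv (blockVec j ε) v) := by
    have hm := mem_of_blockVec_mem h2
      (smallSubmodule hφ h2 (blockVec j ε) (isSmall_transv_blockVec hφ h2 j j ε ε (form_self _)))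
      v fun i => by
        by_cases hi : i = j
        · subst hi; exact Or.inr hv
        · exact Or.inl fun δ => ⟨form_blockVec_ne hi _ _,
            isSmall_transv_blockVec hφ h2 _ _ _ _ (form_blockVec_ne hi _ _)⟩
    rw [show transv (blockVec j ε) v = transv v (blockVec j ε) from
      funext fun a => transv_symm _ _ a]
    exact hm.2
  have h0 (ε : ℤˣ) := form_swap_zero (form_blockVec_of_zero hv ε)
  exact IsSmall.transv_of_commutator hφ (isUnit_form_blockVec h2 j) (h0 _) (h0 _) (h0 _) (h0 _)
    (form_self _) (h 1) (h (-1))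

/-- The vector `v` need not be unimodular: it is the sum of its part `w` in the first block and its
part `u` in the other blocks, and each part vanishes on some block. -/
theorem isSmall_transv_self (hφ : ∀ x : Q, ∃ s ∈ S, ∃ p : P, s • x = φ p)
    (h2 : IsUnit (2 : Q)) (v : Fin (n + 2) × Fin 2 → Q) : IsSmall S φ (transv v v) := by
  let w : Fin (n + 2) × Fin 2 → Q := fun p => if p.1 = 0 then v p else 0
  let u : Fin (n + 2) × Fin 2 → Q := fun p => if p.1 = 0 then 0 else v p
  have hvw : v = w + u := by
    ext p
    by_cases hp : p.1 = 0 <;> simp [u, w, hp]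
  have hu : ∀ k, u (0, k) = 0 := by simp [u]
  have hw : ∀ k, w (1, k) = 0 := by simp [w]
  have hus := isSmall_transv_self_of_zero hφ h2 hu
  have hws := isSmall_transv_self_of_zero hφ h2 hw
  have hm := mem_of_blockVec_mem h2 (smallSubmodule hφ h2 u hus) w fun i => by
    by_cases hi : i = 0
    · subst hi
      refine Or.inl fun ε => ⟨form_swap_zero (form_blockVec_of_zero hu _), ?_⟩
      have hm' := mem_of_blockVec_mem h2 (smallSubmodule hφ h2 (blockVec 0 ε)
        (isSmall_transv_blockVec hφ h2 0 0 ε ε (form_self _))) u fun i => by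
          by_cases hi : i = 0
          · subst hi; exact Or.inr hu
          · exact Or.inl fun δ => ⟨form_blockVec_ne hi _ _,
              isSmall_transv_blockVec hφ h2 _ _ _ _ (form_blockVec_ne hi _ _)⟩
      rw [show transv (blockVec 0 ε) u = transv u (blockVec 0 ε) from
        funext fun a => transv_symm _ _ a]
      exact hm'.2
    · exact Or.inr fun k => by simp [w, hi]
  have h := (hws.mul hus).mul (hm.2.comp_mul hφ 2)
  rw [hvw]
  convert h using 2 with a
  exact transv_add_add hm.1 a

/-- By polarization, from the case `u = v`. -/
theorem isSmall_transv (hφ : ∀ x : Q, ∃ s ∈ S, ∃ p : P, s • x = φ p)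
    (h2 : IsUnit (2 : Q)) {u v : Fin (n + 2) × Fin 2 → Q} (h : form (n + 2) Q u v = 0) :
    IsSmall S φ (transv u v) := by
  obtain ⟨c, hc⟩ := h2.exists_right_inv
  have hs (w : Fin (n + 2) × Fin 2 → Q) (d : Q) := (isSmall_transv_self hφ h2 w).comp_mul hφ d
  have h' := ((hs v (-c)).mul (hs u (-c))).mul (hs (u + v) c)
  convert h' using 2 with a
  have e (w : Fin (n + 2) × Fin 2 → Q) : transv w w (-c * a) * transv w w (c * a) = 1 := by
    rw [transv_mul_transv (form_self w), neg_mul, neg_add_cancel, transv_zero]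
  rw [transv_add_add h, ← mul_assoc, ← mul_assoc, mul_assoc (transv v v _), e, mul_one, e, one_mul,
    ← mul_assoc, hc, one_mul]

/-- Conjugation by a symplectic matrix `h` with inverse `h'` is continuous. -/
theorem exists_conj_mem_congruenceMonoid (hφ : ∀ x : Q, ∃ s ∈ S, ∃ p : P, s • x = φ p)
    (h2 : IsUnit (2 : Q)) {h h' : Mat n Q} (hh : hᵀ * psi n Q * h = psi n Q) (hi : h * h' = 1)
    {s : R} (hs : s ∈ S) :
    ∃ t ∈ S, ∀ M ∈ congruenceMonoid n φ t, h * M * h' ∈ congruenceMonoid n φ s := by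
  have hi' : h' * h = 1 := mul_eq_one_comm.1 hi
  have small (ε δ : ℤˣ) (i : Fin n) :
      IsSmall S φ fun a => h * root ε δ (Pi.single i a) * h' := by
    -- With at most one block there is nothing to conjugate: the generators are all trivial.
    by_cases hn : Subsingleton (Fin n)
    · simp only [root_of_subsingleton, mul_one, hi]
      exact IsSmall.one
    obtain ⟨m, rfl⟩ : ∃ m, n = m + 2 := by
      rw [Fin.subsingleton_iff_le_one] at hn
      exact ⟨n - 2, by omega⟩
    by_cases h0 : i = 0
    · -- The first parameter is not used by `E`.
      have (a : Q) : root ε δ (Pi.single (0 : Fin (m + 2)) a) = 1 := by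
        rw [root_eq_transv]
        convert transv_zero_left _ _ using 2
        ext p
        by_cases hp : p.1 = 0 <;> simp [hp]
      subst h0
      simp only [this, mul_one, hi]
      exact IsSmall.one
    · simp only [root_single ε δ h0, conj_transv hh hi]
      refine (isSmall_transv hφ h2 ?_).comp_mul hφ _
      rw [form_mulVec hh, form_blockVec_ne (Ne.symm h0)]
  choose t htS ht using fun k : ℤˣ × ℤˣ × Fin n => small k.1 k.2.1 k.2.2 s hs
  refine ⟨∏ k, t k, prod_mem fun k _ => htS k, fun M hM => ?_⟩
  refine Submonoid.closure_induction (motive := fun M _ => h * M * h' ∈ congruenceMonoid n φ s)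
    ?_ ?_ ?_ hM
  · rintro _ ⟨ε, δ, a, rfl⟩
    have hsum : (fun i => φ ((∏ k, t k) • a i)) =
        ∑ i, Pi.single i (φ ((∏ k, t k) • a i)) := (Finset.univ_sum_single _).symm
    rw [hsum]
    refine Finset.sum_induction _ (fun b => h * root ε δ b * h' ∈ congruenceMonoid n φ s)
      ?_ ?_ ?_
    · intro b c hb hc
      rw [root_add]
      have := mul_mem hb hc
      rwa [show h * root ε δ b * h' * (h * root ε δ c * h') =
        h * root ε δ b * (h' * h) * root ε δ c * h' by simp only [mul_assoc], hi', mul_one,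
        mul_assoc h] at this
    · rw [root_zero, mul_one, hi]; exact one_mem _
    · intro i _
      obtain ⟨c, hc⟩ := Finset.dvd_prod_of_mem t (Finset.mem_univ (ε, δ, i))
      rw [hc, mul_smul]
      exact ht (ε, δ, i) _
  · rw [mul_one, hi]; exact one_mem _
  · intro x y _ _ hx hy
    have := mul_mem hx hy
    rwa [show h * x * h' * (h * y * h') = h * x * (h' * h) * y * h' by simp only [mul_assoc],
      hi', mul_one, mul_assoc h] at this

end Orthogonal

/-! ### Functoriality of the group and substitution -/

section Functoriality

theorem map_mem_H {n : ℕ} {K K' : Type*} [CommRing K] [CommRing K'] (f : K →+* K') {g : SL n K}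
    (hg : g ∈ H n K) : Matrix.SpecialLinearGroup.map f g ∈ H n K' := by
  have : H n K ≤ (H n K').comap (Matrix.SpecialLinearGroup.map f) := by
    refine (Subgroup.closure_le _).2 fun g hg => Subgroup.subset_closure ?_
    obtain ⟨ε, δ, a, ha⟩ := isBasic_iff.1 hg
    refine isBasic_iff.2 ⟨ε, δ, f ∘ a, ?_⟩
    rw [← map_root, ← ha]
    rfl
  exact this hg

/-- The substitution `α(X) ↦ α(x)`. -/
noncomputable def subst {n : ℕ} {R P : Type*} [CommRing R] [CommRing P] [Algebra R P] (x : P) :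
    SL n R[X] →* SL n P :=
  Matrix.SpecialLinearGroup.map (Polynomial.aeval x : R[X] →ₐ[R] P).toRingHom

theorem coe_subst {n : ℕ} {R P : Type*} [CommRing R] [CommRing P] [Algebra R P] (x : P)
    (g : SL n R[X]) :
    (subst x g : Mat n P) = (g : Mat n R[X]).map (Polynomial.aeval x : R[X] →ₐ[R] P) := rfl

theorem map_subst {n : ℕ} {R P P' : Type*} [CommRing R] [CommRing P] [Algebra R P] [CommRing P']
    [Algebra R P'] (f : P →ₐ[R] P') (x : P) (g : SL n R[X]) :
    Matrix.SpecialLinearGroup.map f.toRingHom (subst x g) = subst (f x) g := by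
  ext i j
  exact (Polynomial.aeval_algHom_apply f x _).symm

theorem subst_localize {n : ℕ} {R Q : Type*} [CommRing R] (m : Ideal R) [m.IsPrime] [CommRing Q]
    [Algebra R Q] [Algebra (Localization.AtPrime m) Q] [IsScalarTower R (Localization.AtPrime m) Q]
    (x : Q) (g : SL n R[X]) : subst x (localize m g) = subst x g := by
  ext i j
  exact Polynomial.aeval_map_algebraMap _ x _

/-- Elements of a congruence monoid lift to elements of `H` over the ring without denominators. -/
theorem exists_map_eq_of_mem_congruenceMonoid {n : ℕ} {R P Q : Type*} [CommRing R] [CommRing P]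
    [CommRing Q] [Algebra R P] [Algebra R Q] (φ : P →ₐ[R] Q) (s : R) {M : Mat n Q}
    (hM : M ∈ congruenceMonoid n φ s) : ∃ g ∈ H n P, (g : Mat n P).map φ = M := by
  induction hM using Submonoid.closure_induction with
  | mem M hM =>
    obtain ⟨ε, δ, a, rfl⟩ := hM
    have hb : IsBasic (root ε δ fun i => s • a i) := isBasic_iff.2 ⟨ε, δ, _, rfl⟩
    have hg : (⟨_, hb.det_and_symp.1⟩ : SL n P) ∈ H n P :=
      Subgroup.subset_closure (Set.mem_ofPred_eq ▸ hb)
    exact ⟨_, hg, map_root φ.toRingHom ε δ fun i => s • a i⟩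
  | one => exact ⟨1, one_mem _, by simp⟩
  | mul x y _ _ hx hy =>
    obtain ⟨g, hg, rfl⟩ := hx
    obtain ⟨h, hh, rfl⟩ := hy
    refine ⟨g * h, mul_mem hg hh, ?_⟩
    rw [Matrix.SpecialLinearGroup.coe_mul]
    exact map_mul φ.toRingHom.mapMatrix (g : Mat n P) h

end Functoriality

/-! ### Removing the denominators of an increment -/

section Dilation

variable {R P Q : Type*} [CommRing R] [CommRing P] [CommRing Q] [Algebra R P] [Algebra R Q]
variable {S : Submonoid R} {φ : P →ₐ[R] Q}

/-- If `u` is a denominator of the coefficients of `p`, then `p(y + u c z) - p(y)` has no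
denominator, and it is divisible by `c`. -/
theorem exists_aeval_sub_aeval (Rs : Type*) [CommRing Rs] [Algebra R Rs] [IsLocalization S Rs]
    [Algebra Rs Q] [IsScalarTower R Rs Q] (y z : P) (p : Rs[X]) :
    ∃ u ∈ S, ∀ c : R, ∃ a : P,
      Polynomial.aeval (φ (y + (u * c) • z)) p - Polynomial.aeval (φ y) p = φ (c • a) := by
  obtain ⟨u, hu, hp⟩ := IsLocalization.integerNormalization_spec S p
  set q := IsLocalization.integerNormalization S p
  refine ⟨u, hu, fun c => ?_⟩
  have hunit : IsUnit (algebraMap R Q u) := by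
    rw [IsScalarTower.algebraMap_apply R Rs Q]
    exact (IsLocalization.map_units Rs ⟨u, hu⟩).map _
  have hx (x : P) : algebraMap R Q u * Polynomial.aeval (φ x) p = φ (Polynomial.aeval x q) := by
    have h := congrArg (Polynomial.aeval (φ x)) hp
    rw [Polynomial.aeval_map_algebraMap, Polynomial.aeval_algHom_apply] at h
    rw [h, ← Algebra.smul_def, ← algebraMap_smul Rs u p, map_smul, algebraMap_smul]
  have hd := Polynomial.sub_dvd_eval_sub (y + (u * c) • z) y (q.map (algebraMap R P))
  rw [Polynomial.eval_map_algebraMap, Polynomial.eval_map_algebraMap, add_sub_cancel_left] at hd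
  obtain ⟨a, ha⟩ := hd
  refine ⟨z * a, hunit.mul_left_cancel ?_⟩
  rw [mul_sub, hx, hx, ← map_sub, ha, ← Algebra.smul_def, ← map_smul, smul_smul, smul_mul_assoc]

/-- For `g ∈ H`, the matrices `g(y + t c z) g(y)⁻¹` lie in any given congruence monoid once `t` is
divisible enough, uniformly in `c`. For a product `g h` this matrix is that of `g` times the
conjugate by `g(y)` of that of `h`, so that continuity of conjugation makes the induction work. -/
theorem exists_subst_mem_congruenceMonoid {n : ℕ} (hφ : ∀ x : Q, ∃ s ∈ S, ∃ p : P, s • x = φ p)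
    (h2 : IsUnit (2 : Q)) (Rs : Type*) [CommRing Rs] [Algebra R Rs] [IsLocalization S Rs]
    [Algebra Rs Q] [IsScalarTower R Rs Q] (y z : P) {g : SL n Rs[X]} (hg : g ∈ H n Rs[X]) :
    ∀ s ∈ S, ∃ t ∈ S, ∀ c : R,
      ((subst (φ (y + (t * c) • z)) g * (subst (φ y) g)⁻¹ : SL n Q) : Mat n Q) ∈
        congruenceMonoid n φ s := by
  have hroot (g : SL n Rs[X]) (ε δ : ℤˣ) (a : Fin n → Rs[X])
      (hg : (g : Mat n Rs[X]) = root ε δ a) : ∀ s ∈ S, ∃ t ∈ S, ∀ c : R,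
        ((subst (φ (y + (t * c) • z)) g * (subst (φ y) g)⁻¹ : SL n Q) : Mat n Q) ∈
          congruenceMonoid n φ s := by
    intro s hs
    choose u huS hu using fun i => exists_aeval_sub_aeval (φ := φ) (S := S) Rs y z (a i)
    refine ⟨s * ∏ i, u i, mul_mem hs (prod_mem fun i _ => huS i), fun c => ?_⟩
    have hx (x : Q) : (subst x g : Mat n Q) = root ε δ fun i => Polynomial.aeval x (a i) := by
      rw [coe_subst, hg]
      exact map_root (Polynomial.aeval x : Rs[X] →ₐ[Rs] Q).toRingHom _ _ _
    have hb : ∀ i, ∃ b : P, Polynomial.aeval (φ (y + ((s * ∏ i, u i) * c) • z)) (a i) -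
        Polynomial.aeval (φ y) (a i) = φ (s • b) := by
      intro i
      obtain ⟨d, hd⟩ := Finset.dvd_prod_of_mem u (Finset.mem_univ i)
      obtain ⟨b, hb⟩ := hu i (s * (d * c))
      rw [mul_smul s] at hb
      refine ⟨(d * c) • b, ?_⟩
      rw [← hb, hd, show s * (u i * d) * c = u i * (s * (d * c)) by ring]
    choose b hb using hb
    refine Submonoid.subset_closure ⟨ε, δ, b, ?_⟩
    have hinv : ((subst (φ y) g)⁻¹ : SL n Q) =
        root ε δ fun i => -Polynomial.aeval (φ y) (a i) := by
      have h1 : ((subst (φ y) g : SL n Q) : Mat n Q) * ((subst (φ y) g)⁻¹ : SL n Q) = 1 := by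
        rw [← Matrix.SpecialLinearGroup.coe_mul, mul_inv_cancel,
          Matrix.SpecialLinearGroup.coe_one]
      have h2 : (root ε δ fun i => -Polynomial.aeval (φ y) (a i)) *
          ((subst (φ y) g : SL n Q) : Mat n Q) = 1 := by
        rw [hx, ← root_add, ← root_zero ε δ]
        congr 1
        ext i
        simp
      exact (left_inv_eq_right_inv h2 h1).symm
    rw [Matrix.SpecialLinearGroup.coe_mul, hinv, hx, ← root_add]
    congr 1
    ext i
    rw [← hb]
    simp [sub_eq_add_neg]
  induction hg using Subgroup.closure_induction'' with
  | one =>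
    intro s hs
    refine ⟨s, hs, fun c => ?_⟩
    simp only [map_one, inv_one, mul_one, Matrix.SpecialLinearGroup.coe_one]
    exact one_mem _
  | mem g hg =>
    obtain ⟨ε, δ, a, ha⟩ := isBasic_iff.1 hg
    exact hroot g ε δ a ha
  | inv_mem g hg =>
    obtain ⟨ε, δ, a, ha⟩ := isBasic_iff.1 hg
    refine hroot _ ε δ (-a) ?_
    have h1 : (g : Mat n Rs[X]) * ((g⁻¹ : SL n Rs[X]) : Mat n Rs[X]) = 1 := by
      rw [← Matrix.SpecialLinearGroup.coe_mul, mul_inv_cancel, Matrix.SpecialLinearGroup.coe_one]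
    refine (left_inv_eq_right_inv (a := (g : Mat n Rs[X])) ?_ h1).symm
    rw [ha, ← root_add, neg_add_cancel, root_zero]
  | mul g h hgm _ hg hh =>
    intro s hs
    obtain ⟨t, ht, h1⟩ := hg s hs
    set k : SL n Q := subst (φ y) g
    have hk : k ∈ H n Q := map_mem_H _ hgm
    have hk1 : (k : Mat n Q) * ((k⁻¹ : SL n Q) : Mat n Q) = 1 := by
      rw [← Matrix.SpecialLinearGroup.coe_mul, mul_inv_cancel, Matrix.SpecialLinearGroup.coe_one]
    obtain ⟨s', hs', hc⟩ := exists_conj_mem_congruenceMonoid hφ h2 (H_le_Sp n hk) hk1 hs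
    obtain ⟨u, hu, h3⟩ := hh s' hs'
    refine ⟨t * u, mul_mem ht hu, fun c => ?_⟩
    have e1 := h1 (u * c)
    have e2 := hc _ (h3 (t * c))
    rw [show t * (u * c) = t * u * c by ring] at e1
    rw [show u * (t * c) = t * u * c by ring, ← Matrix.SpecialLinearGroup.coe_mul,
      ← Matrix.SpecialLinearGroup.coe_mul] at e2
    have e := mul_mem e1 e2
    rw [← Matrix.SpecialLinearGroup.coe_mul] at e
    convert e using 2
    rw [map_mul, map_mul]
    simp only [k]
    group

end Dilation

/-! ### From a maximal ideal to an element outside of it -/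

section Gluing

theorem comp_C_mul_X_eq_zero {B : Type*} [CommRing B] {e : B[X]} {s : B} (h0 : e.coeff 0 = 0)
    (hs : s • e = 0) : e.comp (Polynomial.C s * Polynomial.X) = 0 := by
  ext k
  rw [Polynomial.comp_C_mul_X_coeff, Polynomial.coeff_zero]
  cases k with
  | zero => rw [h0, zero_mul]
  | succ k =>
    have := congrArg (fun p => Polynomial.coeff p (k + 1)) hs
    simp only [Polynomial.coeff_smul, smul_eq_mul, Polynomial.coeff_zero] at this
    rw [pow_succ', ← mul_assoc, mul_comm _ s, this, zero_mul]

/-- If the matrices `β(Z)` and `θ(Z)` have the same product with `s`, and `θ(0) = 1`, then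
`β(s Z) = θ(s Z) β(0)`: the difference `β - θ β(0)` is killed by `s` and vanishes at `Z = 0`, so
that each of its terms is killed by `Z ↦ s Z`. -/
theorem map_comp_eq_of_smul_eq {n : ℕ} {B : Type*} [CommRing B] (β θ : SL n B[X]) (s : B)
    (h : s • (β : Mat n B[X]) = s • (θ : Mat n B[X]))
    (h0 : Matrix.SpecialLinearGroup.map (Polynomial.aeval 0 : B[X] →ₐ[B] B[X]).toRingHom θ = 1) :
    Matrix.SpecialLinearGroup.map (Polynomial.aeval (Polynomial.C s * Polynomial.X) :
        B[X] →ₐ[B] B[X]).toRingHom β =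
      Matrix.SpecialLinearGroup.map (Polynomial.aeval (Polynomial.C s * Polynomial.X) :
        B[X] →ₐ[B] B[X]).toRingHom θ *
      Matrix.SpecialLinearGroup.map (Polynomial.aeval 0 : B[X] →ₐ[B] B[X]).toRingHom β := by
  set τ : B[X] →ₐ[B] B[X] := Polynomial.aeval (Polynomial.C s * Polynomial.X)
  set κ : B[X] →ₐ[B] B[X] := Polynomial.aeval 0
  have hκκ (p : B[X]) : κ (κ p) = κ p := by
    rw [← Polynomial.aeval_algHom_apply, map_zero]
  have hτκ (p : B[X]) : τ (κ p) = κ p := by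
    rw [← Polynomial.aeval_algHom_apply, map_zero]
  have hθ : (θ : Mat n B[X]).map κ = 1 := congrArg (fun g : SL n B[X] => (g : Mat n B[X])) h0
  let D : Mat n B[X] := (β : Mat n B[X]) - (θ : Mat n B[X]) * (β : Mat n B[X]).map κ
  have hsκ : s • (β : Mat n B[X]).map κ = s • (1 : Mat n B[X]) := by
    have := congrArg (fun M : Mat n B[X] => M.map κ) h
    simp only [Matrix.map_smul _ s (fun a => map_smul κ s a)] at this
    rw [this, hθ]
  have hs : s • D = 0 := by
    rw [smul_sub, h, ← Matrix.mul_smul, hsκ, Matrix.mul_smul, mul_one, sub_self]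
  have hmap (f : B[X] →ₐ[B] B[X]) : D.map f = (β : Mat n B[X]).map f -
      (θ : Mat n B[X]).map f * ((β : Mat n B[X]).map κ).map f := by
    have := map_sub f.toRingHom.mapMatrix (β : Mat n B[X])
      ((θ : Mat n B[X]) * (β : Mat n B[X]).map κ)
    rw [map_mul] at this
    exact this
  have hD0 : D.map κ = 0 := by
    rw [hmap, hθ, one_mul, Matrix.map_map, sub_eq_zero]
    ext i j
    simp [hκκ]
  have hDτ : D.map τ = 0 := by
    refine Matrix.ext fun i j => ?_
    have h1 : κ (D i j) = 0 := congrFun (congrFun hD0 i) j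
    have h2 : s • D i j = 0 := congrFun (congrFun hs i) j
    rw [Matrix.map_apply, Matrix.zero_apply, ← Polynomial.comp_eq_aeval]
    refine comp_C_mul_X_eq_zero ?_ h2
    have h3 := congrArg (Polynomial.eval 0) h1
    simpa [κ, Polynomial.aeval_def, Polynomial.coeff_zero_eq_eval_zero] using h3
  rw [hmap, sub_eq_zero, Matrix.map_map] at hDτ
  refine Subtype.ext (hDτ.trans ?_)
  rw [Matrix.SpecialLinearGroup.coe_mul]
  congr 1
  exact Matrix.ext fun i j => hτκ _

variable {R : Type*} [CommRing R]

/-- The matrix `α(y + t z) α(y)⁻¹` agrees with an element of `H` in the localization at `m`, hence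
after multiplication by some `s ∉ m`. -/
theorem exists_smul_eq_smul_subst (h2 : IsUnit (2 : R)) {n : ℕ} (α : SL n R[X])
    (m : Ideal R) [m.IsPrime] (hm : localize m α ∈ H n (Localization.AtPrime m)[X])
    {P : Type*} (Q : Type*) [CommRing P] [CommRing Q] [Algebra R P] [Algebra R Q] [Algebra P Q]
    [IsScalarTower R P Q] [IsLocalization (Algebra.algebraMapSubmonoid P m.primeCompl) Q]
    [Algebra (Localization.AtPrime m) Q] [IsScalarTower R (Localization.AtPrime m) Q] (y z : P) :
    ∃ s ∈ m.primeCompl, ∃ t ∈ m.primeCompl, ∃ β ∈ H n P,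
      s • (β : Mat n P) = s • ((subst (y + t • z) α * (subst y α)⁻¹ : SL n P) : Mat n P) := by
  let φ : P →ₐ[R] Q := IsScalarTower.toAlgHom R P Q
  have hφ : ∀ x : Q, ∃ s ∈ m.primeCompl, ∃ p : P, s • x = φ p := by
    intro x
    obtain ⟨⟨p, ⟨_, s, hs, rfl⟩⟩, hp⟩ :=
      IsLocalization.surj (Algebra.algebraMapSubmonoid P m.primeCompl) x
    refine ⟨s, hs, p, ?_⟩
    rw [Algebra.smul_def, mul_comm, IsScalarTower.algebraMap_apply R P Q]
    exact hp
  have hker : ∀ p q : P, φ p = φ q → ∃ s ∈ m.primeCompl, s • p = s • q := by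
    intro p q hpq
    obtain ⟨⟨_, s, hs, rfl⟩, h⟩ := IsLocalization.exists_of_eq (S := Q)
      (M := Algebra.algebraMapSubmonoid P m.primeCompl) hpq
    exact ⟨s, hs, by simpa only [Algebra.smul_def] using h⟩
  have h2Q : IsUnit (2 : Q) := map_ofNat (algebraMap R Q) 2 ▸ h2.map (algebraMap R Q)
  obtain ⟨t, ht, hsub⟩ := exists_subst_mem_congruenceMonoid hφ h2Q
    (Localization.AtPrime m) y z hm 1 (one_mem _)
  have hmem := hsub 1
  rw [mul_one, subst_localize, subst_localize, ← map_subst, ← map_subst, ← map_inv,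
    ← map_mul] at hmem
  obtain ⟨β, hβ, hβθ⟩ := exists_map_eq_of_mem_congruenceMonoid φ 1 hmem
  have hent (k : (Fin n × Fin 2) × (Fin n × Fin 2)) : φ ((β : Mat n P) k.1 k.2) =
      φ (((subst (y + t • z) α * (subst y α)⁻¹ : SL n P) : Mat n P) k.1 k.2) :=
    congrFun (congrFun hβθ k.1) k.2
  choose u huS hu using fun k => hker _ _ (hent k)
  refine ⟨∏ k, u k, prod_mem fun k _ => huS k, t, ht, β, hβ, Matrix.ext fun i j => ?_⟩
  obtain ⟨d, hd⟩ := Finset.dvd_prod_of_mem u (Finset.mem_univ (i, j))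
  rw [Matrix.smul_apply, Matrix.smul_apply, hd, mul_comm, mul_smul, mul_smul, hu (i, j)]

/-- The local statement: for some `s ∉ m`, the class of `α(d X)` modulo `H` depends only on `d`
modulo `s`. It is uniform in `d` because it is proved for `α(Y + s Z) α(Y)⁻¹` with two independent
variables, and then specialized to `Y = d X` and `Z = c X`. -/
theorem exists_not_mem_forall_subst_mem_H (h2 : IsUnit (2 : R)) {n : ℕ} (α : SL n R[X])
    (m : Ideal R) [m.IsPrime] (hm : localize m α ∈ H n (Localization.AtPrime m)[X]) :
    ∃ s, s ∉ m ∧ ∀ d c : R,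
      subst ((d + s * c) • (Polynomial.X : R[X])) α * (subst (d • (Polynomial.X : R[X])) α)⁻¹ ∈
        H n R[X] := by
  let y : R[X][X] := Polynomial.C Polynomial.X
  obtain ⟨s, hs, t, ht, β, hβ, hsβ⟩ := exists_smul_eq_smul_subst h2 α m hm
    (Localization (Algebra.algebraMapSubmonoid R[X][X] m.primeCompl)) y Polynomial.X
  have hCs (M : Mat n R[X][X]) : (Polynomial.C s : R[X]) • M = s • M := algebraMap_smul R[X] s M
  rw [← hCs, ← hCs] at hsβ
  have hsubst (f : R[X][X] →ₐ[R[X]] R[X][X]) (x : R[X][X]) (g : SL n R[X]) :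
      Matrix.SpecialLinearGroup.map f.toRingHom (subst x g) = subst (f x) g :=
    map_subst (f.restrictScalars R) x g
  have hy (f : R[X][X] →ₐ[R[X]] R[X][X]) : f y = y := f.commutes _
  have hz (f : R[X][X] →ₐ[R[X]] R[X][X]) (x : R[X][X]) : f (y + t • x) = y + t • f x := by
    rw [map_add, hy]
    congr 1
    exact map_smul (f.restrictScalars R) t x
  have hθ0 : Matrix.SpecialLinearGroup.map
      (Polynomial.aeval 0 : R[X][X] →ₐ[R[X]] R[X][X]).toRingHom
      (subst (y + t • Polynomial.X) α * (subst y α)⁻¹ : SL n R[X][X]) = 1 := by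
    rw [map_mul, map_inv, hsubst, hsubst, hy, hz, Polynomial.aeval_X, smul_zero, add_zero,
      mul_inv_cancel]
  have key := map_comp_eq_of_smul_eq β _ (Polynomial.C s) hsβ hθ0
  rw [← mul_inv_eq_iff_eq_mul] at key
  have hmemP : Matrix.SpecialLinearGroup.map (Polynomial.aeval
      (Polynomial.C (Polynomial.C s) * Polynomial.X) : R[X][X] →ₐ[R[X]] R[X][X]).toRingHom
      (subst (y + t • Polynomial.X) α * (subst y α)⁻¹ : SL n R[X][X]) ∈ H n R[X][X] := by
    rw [← key]
    exact mul_mem (map_mem_H _ hβ) (inv_mem (map_mem_H _ hβ))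
  rw [map_mul, map_inv, hsubst, hsubst, hy, hz, Polynomial.aeval_X] at hmemP
  refine ⟨t * s, fun h => mul_mem ht hs h, fun d c => ?_⟩
  let χ : R[X][X] →ₐ[R] R[X] := Polynomial.aevalTower
    (Polynomial.aeval (d • Polynomial.X)) (c • Polynomial.X)
  have hfin := map_mem_H χ.toRingHom hmemP
  rw [map_mul, map_inv, map_subst, map_subst] at hfin
  have hχy : χ y = d • (Polynomial.X : R[X]) := by
    simp [χ, y]
  have hχz : χ (y + t • (Polynomial.C (Polynomial.C s) * Polynomial.X)) =
      (d + t * s * c) • (Polynomial.X : R[X]) := by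
    rw [map_add, map_smul, hχy]
    simp [χ, Polynomial.smul_eq_C_mul]
    ring
  rwa [hχy, hχz] at hfin

end Gluing

end ABCD

/-- Local Global Principle for the group generated by the elements `E(A)`, `E(B)`, `E(C)`, `E(D)`. -/
theorem theorem4p5 {R : Type*} [CommRing R] (h2 : IsUnit (2 : R)) (n : ℕ)
    (α : ABCD.SL n (Polynomial R)) (hα : α ∈ ABCD.Sp n (Polynomial R))
    (h0 : ABCD.evalZero α = 1)
    (hloc : ∀ (m : Ideal R) [m.IsMaximal],
      ABCD.localize m α ∈ ABCD.H n (Polynomial (Localization.AtPrime m))) :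
    α ∈ ABCD.H n (Polynomial R) := by
  -- The elements `s` such that `α(d X)` modulo `H` depends only on `d` modulo `s` form an ideal
  -- that lies in no maximal ideal; so `1` is one of them, and `α(X)` may be compared with `α(0)`.
  let J : Ideal R :=
    { carrier := {s | ∀ d c : R, ABCD.subst ((d + s * c) • (Polynomial.X : R[X])) α *
        (ABCD.subst (d • (Polynomial.X : R[X])) α)⁻¹ ∈ ABCD.H n (Polynomial R)}
      zero_mem' := fun d c => by
        rw [zero_mul, add_zero, mul_inv_cancel]
        exact one_mem _
      add_mem' := fun {s t} hs ht d c => by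
        have h := mul_mem (ht (d + s * c) c) (hs d c)
        rw [mul_assoc, inv_mul_cancel_left] at h
        rwa [add_mul, ← add_assoc]
      smul_mem' := fun r s hs d c => by
        have h := hs d (r * c)
        rwa [smul_eq_mul, show r * s * c = s * (r * c) by ring] }
  have hJ : J = ⊤ := by
    by_contra hne
    obtain ⟨m, hm, hle⟩ := J.exists_le_maximal hne
    obtain ⟨s, hs, h⟩ := ABCD.exists_not_mem_forall_subst_mem_H h2 α m (hloc m)
    exact hs (hle h)
  have h1 : (1 : R) ∈ J := hJ ▸ Submodule.mem_top
  have h := h1 0 1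
  have e1 : ABCD.subst (Polynomial.X : R[X]) α = α := by
    ext i j : 3
    rw [ABCD.coe_subst, Matrix.map_apply, Polynomial.aeval_X_left_apply]
  have e0 : ABCD.subst (0 : R[X]) α = 1 := by
    have h := ABCD.map_subst (Algebra.ofId R R[X]) 0 α
    rw [map_zero] at h
    rw [← h]
    have h' : ABCD.subst (0 : R) α = ABCD.evalZero α := by
      ext i j
      exact Polynomial.aeval_def (0 : R) _
    rw [h', h0, map_one]
  rwa [zero_add, one_mul, one_smul, zero_smul, e1, e0, inv_one, mul_one] at h
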